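/- Let $S_n$ be the group of permutations of $\{1,\dots,n\}$, with $(\sigma\tau)(i)=\sigma(\tau(i))$. A lazy transposition with parameters $(a,b,p)$, where $a\neq b$ and $p\in[0,1]$, is a random permutation that equals the transposition $(a\;b)$ with probability $p$ and the identity otherwise. A sequence $(a_i,b_i,p_i)_{i=1}^{\ell}$ is a transposition shuffle of order $n$ and length $\ell$ if the composition $T_1\cdots T_\ell$ of independent lazy transpositions $T_i$ with parameters $(a_i,b_i,p_i)$ is uniformly distributed on $S_n$; it is simple if $b_i=a_i+1$ for all $i$. For $1\le a<n$ write $t(a)=(a\;\,a{+}1)$. A reduced word of order $n$ is a sequence $(a_i)_{i=1}^{\ell}$ with $\ell=\binom n2$ such that $t(a_1)\cdots t(a_\ell)$ is the reverse permutation $i\mapsto n+1-i$. For a reduced word $(a_i)_{i=1}^\ell$ put $\sigma_j=t(a_1)\cdots t(a_j)$, $u_j=\sigma_{j-1}(a_j)$, $v_j=\sigma_{j-1}(a_j+1)$, and $$p_j=\frac{v_j-u_j}{v_j-u_j+1}\qquad(1\le j\le \ell).$$ Theorem. The minimum length of a simple transposition shuffle of order $n$ is $\binom n2$. For every reduced word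 $(a_i)_{i=1}^\ell$ of order $n$, the sequence $(a_i,a_i+1,p_i)_{i=1}^\ell$ with the probabilities $p_i$ above is a simple transposition shuffle. Conversely, every simple transposition shuffle of order $n$ of length $\binom n2$ is obtained in this way from a reduced word. In particular, for each reduced word $(a_i)_{i=1}^\ell$ there is exactly one sequence $(q_i)_{i=1}^\ell$ such that $(a_i,a_i+1,q_i)_{i=1}^\ell$ is a simple transposition shuffle. -/

import Mathlib

/-- The parameters `(a, b, p)` of a lazy transposition of `n` positions. The positions, and the
elements, are `0, …, n - 1` rather than `1, …, n`. -/
@[ext]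
structure LazyParam (n : ℕ) where
  a : Fin n
  b : Fin n
  p : ℝ

/-- Admissible parameters: two different positions and a number that is a probability. -/
def LazyParam.IsValid {n : ℕ} (s : LazyParam n) : Prop :=
  s.a ≠ s.b ∧ 0 ≤ s.p ∧ s.p ≤ 1

/-- A biased coin, which shows `true` with probability `p`. -/
noncomputable def biasedCoin (p : ℝ) (h0 : 0 ≤ p) (h1 : p ≤ 1) : PMF Bool :=
  PMF.ofFintype (fun c => if c then ENNReal.ofReal p else ENNReal.ofReal (1 - p)) (by
    rw [Fintype.sum_bool]
    simp only [if_true, Bool.false_eq_true, if_false]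
    rw [← ENNReal.ofReal_add h0 (sub_nonneg.2 h1)]
    simp)

/-- The law of the lazy transposition with parameters `(a, b, p)`: with probability `p` it is the
transposition of `a` and `b`, and otherwise it is the identity. -/
noncomputable def lazyTransposition {n : ℕ} (s : LazyParam n) (h : s.IsValid) :
    PMF (Equiv.Perm (Fin n)) :=
  (biasedCoin s.p h.2.1 h.2.2).map fun c => if c then Equiv.swap s.a s.b else 1

/-- The law of the composition `T₁ ⋯ T_ℓ` of independent random permutations whose laws are the
entries of the list. -/
noncomputable def compositionLaw {n : ℕ} :
    List (PMF (Equiv.Perm (Fin n))) → PMF (Equiv.Perm (Fin n))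
  | [] => PMF.pure 1
  | μ :: L => μ.bind fun τ => (compositionLaw L).map fun π => τ * π

/-- A sequence of parameters is a (perfect) transposition shuffle if its entries are admissible and
the composition of independent lazy transpositions with these parameters is uniform. -/
def IsTranspositionShuffle {n : ℕ} (S : List (LazyParam n)) : Prop :=
  ∃ h : ∀ s ∈ S, s.IsValid,
    compositionLaw (S.pmap lazyTransposition h) = PMF.uniformOfFintype (Equiv.Perm (Fin n))

/-- A simple transposition shuffle transposes adjacent pairs only: `b = a + 1`. -/
def IsSimpleTranspositionShuffle {n : ℕ} (S : List (LazyParam n)) : Prop :=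
  IsTranspositionShuffle S ∧ ∀ s ∈ S, (s.b : ℕ) = (s.a : ℕ) + 1

/-- The left one, `a`, of the adjacent positions `a`, `a + 1`. -/
def leftPos {n : ℕ} (a : Fin (n - 1)) : Fin n := ⟨a, by omega⟩

/-- The right one, `a + 1`, of the adjacent positions `a`, `a + 1`. -/
def rightPos {n : ℕ} (a : Fin (n - 1)) : Fin n := ⟨a + 1, by omega⟩

/-- The simple transposition `t(a)` of the positions `a` and `a + 1`. -/
def simpleTransposition {n : ℕ} (a : Fin (n - 1)) : Equiv.Perm (Fin n) :=
  Equiv.swap (leftPos a) (rightPos a)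

/-- The composition `t(a₁) ⋯ t(a_k)` of the simple transpositions of a word. -/
def wordProd {n : ℕ} (w : List (Fin (n - 1))) : Equiv.Perm (Fin n) :=
  (w.map simpleTransposition).prod

/-- A reduced word of order `n`: a word of length `n.choose 2` whose composition is the
reverse permutation. -/
def IsReducedWord {n : ℕ} (w : List (Fin (n - 1))) : Prop :=
  w.length = n.choose 2 ∧ wordProd w = Fin.revPerm

/-- The parameters `(aᵢ, aᵢ + 1, pᵢ)` given by a word `(aᵢ)` and a list `(pᵢ)` of the same
length. -/
def simpleParams {n : ℕ} (w : List (Fin (n - 1))) (p : List ℝ) : List (LazyParam n) :=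
  List.zipWith (fun a q => ⟨leftPos a, rightPos a, q⟩) w p

/-- The element `u` at the left position just before step `j` of the word is applied
(steps are numbered from `0`). -/
def leftElement {n : ℕ} (w : List (Fin (n - 1))) (j : Fin w.length) : Fin n :=
  wordProd (w.take j) (leftPos (w.get j))

/-- The element `v` at the right position just before step `j` of the word is applied. -/
def rightElement {n : ℕ} (w : List (Fin (n - 1))) (j : Fin w.length) : Fin n :=
  wordProd (w.take j) (rightPos (w.get j))

/-- The probabilities `(v - u) / (v - u + 1)`, where `u`, `v` are the elements transposed at the
step in question. -/
noncomputable def constructionProbs {n : ℕ} (w : List (Fin (n - 1))) : List ℝ :=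
  List.ofFn fun j : Fin w.length =>
    (((rightElement w j : ℕ) : ℝ) - ((leftElement w j : ℕ) : ℝ)) /
      (((rightElement w j : ℕ) : ℝ) - ((leftElement w j : ℕ) : ℝ) + 1)

/-- The sequence of parameters constructed from a word. -/
noncomputable def construction {n : ℕ} (w : List (Fin (n - 1))) : List (LazyParam n) :=
  simpleParams w (constructionProbs w)

/-!
# Shortest shuffles by lazy simple transpositions

A sequence of lazy transpositions acts on functions of a permutation by the operator
`f ↦ (π ↦ 𝔼 f (π T₁ ⋯ T_ℓ))`, which is the product of the operators `(1 - p) + p t` of its terms; the law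
of the composition is read off from this operator.

*Length.* A simple shuffle reaches the reverse permutation, so some subword of its word of
positions has the reverse permutation as its product. Each letter creates at most one inversion
and the reverse permutation has `n.choose 2` of them. Hence the length is at least `n.choose 2`,
and if it is equal, then the word is reduced and *ascending*: each letter transposes a pair of
elements that is in order (`IsReducedWord.ascendingFrom_one`).

*The construction is a shuffle.* Up to a scalar, a step that transposes `u < v` at the positions
`a`, `a + 1` has the operator `1 + (v - u) t(a)`. These operators satisfy the Yang–Baxter equation
`(1 + x s) (1 + (x + y) t) (1 + y s) = (1 + y t) (1 + (x + y) s) (1 + x t)`, and so the product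
along an ascending word that leads to `σ` can be rewritten so that it ends with the factor of any
prescribed descent of `σ` (`IsCrossingProduct.exchange`). At the reverse permutation each `b` is a
descent with factor `1 + t(b)`, which absorbs `t(b)`. Thus the law is invariant under all simple
transpositions on the right, and hence uniform.

*Uniqueness.* For an interval of elements consider the event that all elements outside it end at
their reversed places. This happens if and only if every letter that transposes a pair not
contained in the interval is really applied: the smallest element that deviates from its path can
only stay behind, and it never catches up (`Lags.mul_swap`, `Lags.mul_swap_left`); likewise for
the largest one. So the product of these probabilities is the same for any two shuffles with the
same reduced word (`shuffleOp_agreeOutside`), and after division so is the product over the pairs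
contained in the interval. A pair is transposed only once, so induction on `v - u` separates the
factors (`IsReducedWord.eq_of_isTranspositionShuffle`).
-/

/-! ### Inversions and reduced words -/

theorem leftPos_lt_rightPos {n : ℕ} (a : Fin (n - 1)) : leftPos a < rightPos a := by
  simp [leftPos, rightPos, Fin.lt_def]

theorem leftPos_covBy_rightPos {n : ℕ} (a : Fin (n - 1)) : leftPos a ⋖ rightPos a := by
  refine ⟨leftPos_lt_rightPos a, fun c h1 h2 => ?_⟩
  simp only [leftPos, rightPos, Fin.lt_def] at h1 h2
  omega

theorem simpleTransposition_mul_self {n : ℕ} (a : Fin (n - 1)) :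
    simpleTransposition a * simpleTransposition a = 1 := Equiv.swap_mul_self _ _

theorem simpleTransposition_leftPos {n : ℕ} (a : Fin (n - 1)) :
    simpleTransposition a (leftPos a) = rightPos a := Equiv.swap_apply_left _ _

theorem simpleTransposition_rightPos {n : ℕ} (a : Fin (n - 1)) :
    simpleTransposition a (rightPos a) = leftPos a := Equiv.swap_apply_right _ _

@[simp] theorem wordProd_nil {n : ℕ} : wordProd ([] : List (Fin (n - 1))) = 1 := rfl

@[simp] theorem wordProd_cons {n : ℕ} (a : Fin (n - 1)) (w : List (Fin (n - 1))) :
    wordProd (a :: w) = simpleTransposition a * wordProd w := by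
  simp [wordProd]

theorem wordProd_append {n : ℕ} (v w : List (Fin (n - 1))) :
    wordProd (v ++ w) = wordProd v * wordProd w := by
  simp [wordProd]

/-- The inversions of `σ`, recorded as pairs of elements `x < y` such that `y` stands to the left
of `x`. -/
def inversions {n : ℕ} (σ : Equiv.Perm (Fin n)) : Finset (Fin n × Fin n) :=
  {e | e.1 < e.2 ∧ σ⁻¹ e.2 < σ⁻¹ e.1}

theorem mem_inversions {n : ℕ} {σ : Equiv.Perm (Fin n)} {e : Fin n × Fin n} :
    e ∈ inversions σ ↔ e.1 < e.2 ∧ σ⁻¹ e.2 < σ⁻¹ e.1 := by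
  simp [inversions]

/-- Transposing an adjacent pair that is in order creates exactly one inversion. -/
theorem inversions_mul_simpleTransposition {n : ℕ} {σ : Equiv.Perm (Fin n)} {a : Fin (n - 1)}
    (h : σ (leftPos a) < σ (rightPos a)) :
    inversions (σ * simpleTransposition a) =
      insert (σ (leftPos a), σ (rightPos a)) (inversions σ) := by
  ext ⟨x, y⟩
  obtain ⟨i, rfl⟩ := σ.surjective x
  obtain ⟨j, rfl⟩ := σ.surjective y
  have hc := leftPos_covBy_rightPos a
  have hlt := hc.lt
  have hno : ∀ c, ¬ (leftPos a < c ∧ c < rightPos a) := fun c h => hc.2 h.1 h.2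
  have hi := hno i
  have hj := hno j
  simp only [mem_inversions, Finset.mem_insert, Prod.mk.injEq, mul_inv_rev, Equiv.Perm.mul_apply,
    Equiv.Perm.inv_def, Equiv.symm_apply_apply, EmbeddingLike.apply_eq_iff_eq, simpleTransposition,
    Equiv.symm_swap, Equiv.swap_apply_def]
  generalize leftPos a = l at *
  generalize rightPos a = r at *
  split_ifs <;> subst_vars <;> grind

theorem notMem_inversions {n : ℕ} {σ : Equiv.Perm (Fin n)} {i j : Fin n} (h : i < j) :
    (σ i, σ j) ∉ inversions σ := by
  simp [mem_inversions, h.le]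

theorem card_inversions_mul_of_lt {n : ℕ} {σ : Equiv.Perm (Fin n)} {a : Fin (n - 1)}
    (h : σ (leftPos a) < σ (rightPos a)) :
    (inversions (σ * simpleTransposition a)).card = (inversions σ).card + 1 := by
  rw [inversions_mul_simpleTransposition h,
    Finset.card_insert_of_notMem (notMem_inversions (leftPos_lt_rightPos a))]

theorem card_inversions_mul_of_gt {n : ℕ} {σ : Equiv.Perm (Fin n)} {a : Fin (n - 1)}
    (h : σ (rightPos a) < σ (leftPos a)) :
    (inversions (σ * simpleTransposition a)).card + 1 = (inversions σ).card := by
  have := card_inversions_mul_of_lt (σ := σ * simpleTransposition a) (a := a) (by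
    simpa [simpleTransposition_leftPos, simpleTransposition_rightPos] using h)
  rwa [mul_assoc, simpleTransposition_mul_self, mul_one, eq_comm] at this

theorem apply_leftPos_ne {n : ℕ} (σ : Equiv.Perm (Fin n)) (a : Fin (n - 1)) :
    σ (leftPos a) ≠ σ (rightPos a) := σ.injective.ne (leftPos_lt_rightPos a).ne

theorem card_inversions_one {n : ℕ} : (inversions (1 : Equiv.Perm (Fin n))).card = 0 := by
  rw [Finset.card_eq_zero, Finset.eq_empty_iff_forall_notMem]
  exact fun e he => (mem_inversions.1 he).1.not_gt (mem_inversions.1 he).2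

theorem card_inversions_revPerm {n : ℕ} :
    (inversions (Fin.revPerm : Equiv.Perm (Fin n))).card = n.choose 2 := by
  have : inversions (Fin.revPerm : Equiv.Perm (Fin n)) =
      ({e | e.1 < e.2} : Finset (Fin n × Fin n)) := by
    ext e
    simp [inversions, Equiv.Perm.inv_def]
  rw [this, Fintype.card_product_filter_lt, Fintype.card_fin]

/-- A word is ascending from `σ` if each of its letters, applied in turn to `σ`, transposes an
adjacent pair of elements that is in order. -/
def AscendingFrom {n : ℕ} : Equiv.Perm (Fin n) → List (Fin (n - 1)) → Prop
  | _, [] => True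
  | σ, a :: w => σ (leftPos a) < σ (rightPos a) ∧ AscendingFrom (σ * simpleTransposition a) w

theorem card_inversions_mul_wordProd_le {n : ℕ} (w : List (Fin (n - 1)))
    (σ : Equiv.Perm (Fin n)) :
    (inversions (σ * wordProd w)).card ≤ (inversions σ).card + w.length := by
  induction w generalizing σ with
  | nil => simp
  | cons a w ih =>
    have := ih (σ * simpleTransposition a)
    rw [wordProd_cons, ← mul_assoc, List.length_cons]
    rcases (apply_leftPos_ne σ a).lt_or_gt with h | h
    · have := card_inversions_mul_of_lt h
      omega
    · have := card_inversions_mul_of_gt h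
      omega

theorem ascendingFrom_of_card_inversions {n : ℕ} (w : List (Fin (n - 1)))
    (σ : Equiv.Perm (Fin n))
    (h : (inversions (σ * wordProd w)).card = (inversions σ).card + w.length) :
    AscendingFrom σ w := by
  induction w generalizing σ with
  | nil => trivial
  | cons a w ih =>
    have hle := card_inversions_mul_wordProd_le w (σ * simpleTransposition a)
    rw [wordProd_cons, ← mul_assoc, List.length_cons] at h
    rcases (apply_leftPos_ne σ a).lt_or_gt with h' | h'
    · have := card_inversions_mul_of_lt h'
      exact ⟨h', ih _ (by omega)⟩
    · have := card_inversions_mul_of_gt h'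
      omega

theorem IsReducedWord.ascendingFrom_one {n : ℕ} {w : List (Fin (n - 1))} (hw : IsReducedWord w) :
    AscendingFrom 1 w := by
  apply ascendingFrom_of_card_inversions
  rw [one_mul, hw.2, hw.1, card_inversions_revPerm, card_inversions_one, zero_add]

theorem choose_two_le_length {n : ℕ} {w : List (Fin (n - 1))} (hw : wordProd w = Fin.revPerm) :
    n.choose 2 ≤ w.length := by
  have := card_inversions_mul_wordProd_le w 1
  rwa [one_mul, hw, card_inversions_revPerm, card_inversions_one, zero_add] at this

theorem exists_ascent_of_ne_revPerm {n : ℕ} {σ : Equiv.Perm (Fin n)} (h : σ ≠ Fin.revPerm) :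
    ∃ a : Fin (n - 1), σ (leftPos a) < σ (rightPos a) := by
  by_contra! hd
  apply h
  obtain _ | n := n
  · exact Subsingleton.elim _ _
  have hanti : StrictAnti σ := Fin.strictAnti_iff_succ_lt.2 fun i =>
    (hd i).lt_of_ne (apply_leftPos_ne σ i).symm
  have hmono : StrictMono fun i => σ (Fin.rev i) := fun i j hij => hanti (Fin.rev_lt_rev.2 hij)
  ext i
  have h1 : σ (Fin.rev (Fin.rev i)) = Fin.rev i :=
    le_antisymm (hmono.le_id (Fin.rev i)) (hmono.id_le (Fin.rev i))
  rw [Fin.rev_rev] at h1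
  rw [h1, Fin.revPerm_apply]

theorem exists_isReducedWord (n : ℕ) : ∃ w : List (Fin (n - 1)), IsReducedWord w := by
  have key : ∀ k ≤ n.choose 2, ∃ w : List (Fin (n - 1)), w.length = k ∧
      (inversions (wordProd w)).card = k := by
    intro k
    induction k with
    | zero => exact fun _ => ⟨[], rfl, card_inversions_one⟩
    | succ k ih =>
      intro hk
      obtain ⟨w, h1, h2⟩ := ih (by omega)
      obtain ⟨a, ha⟩ := exists_ascent_of_ne_revPerm (σ := wordProd w) (by
        intro h
        rw [h, card_inversions_revPerm] at h2
        omega)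
      refine ⟨w ++ [a], by simp [h1], ?_⟩
      rw [wordProd_append, wordProd_cons, wordProd_nil, mul_one, card_inversions_mul_of_lt ha, h2]
  obtain ⟨w, h1, h2⟩ := key _ le_rfl
  refine ⟨w, h1, ?_⟩
  by_contra hne
  obtain ⟨a, ha⟩ := exists_ascent_of_ne_revPerm hne
  have h3 := card_inversions_mul_of_lt ha
  have h4 : (inversions (wordProd w * simpleTransposition a)).card ≤ n.choose 2 := by
    have hpairs := Fintype.card_product_filter_lt (α := Fin n)
    rw [Fintype.card_fin] at hpairs
    exact hpairs ▸ Finset.card_le_card fun e he => by simpa using (mem_inversions.1 he).1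
  omega

theorem AscendingFrom.left_lt_right {n : ℕ} {w : List (Fin (n - 1))} {σ : Equiv.Perm (Fin n)}
    (h : AscendingFrom σ w) (j : Fin w.length) :
    (σ * wordProd (w.take j)) (leftPos (w.get j)) <
      (σ * wordProd (w.take j)) (rightPos (w.get j)) := by
  induction w generalizing σ with
  | nil => exact j.elim0
  | cons a w ih =>
    refine Fin.cases ?_ (fun j => ?_) j
    · simpa using h.1
    · simpa [mul_assoc] using ih h.2 j

theorem IsReducedWord.leftElement_lt_rightElement {n : ℕ} {w : List (Fin (n - 1))}
    (hw : IsReducedWord w) (j : Fin w.length) : leftElement w j < rightElement w j := by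
  simpa [leftElement, rightElement] using hw.ascendingFrom_one.left_lt_right j

/-- Along an ascending word no pair of elements is transposed twice: once inverted, a pair stays
inverted. -/
theorem AscendingFrom.injective_crossing {n : ℕ} {w : List (Fin (n - 1))}
    {σ : Equiv.Perm (Fin n)} (h : AscendingFrom σ w) :
    Function.Injective fun j : Fin w.length =>
      ((σ * wordProd (w.take j)) (leftPos (w.get j)),
        (σ * wordProd (w.take j)) (rightPos (w.get j))) := by
  have hnot : ∀ (w : List (Fin (n - 1))) (σ : Equiv.Perm (Fin n)), AscendingFrom σ w →
      ∀ j : Fin w.length, ((σ * wordProd (w.take j)) (leftPos (w.get j)),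
        (σ * wordProd (w.take j)) (rightPos (w.get j))) ∉ inversions σ := by
    intro w
    induction w with
    | nil => exact fun _ _ j => j.elim0
    | cons a w ih =>
      intro σ h j
      refine Fin.cases ?_ (fun j => ?_) j
      · simpa using notMem_inversions (σ := σ) (leftPos_lt_rightPos a)
      · have := ih _ h.2 j
        rw [inversions_mul_simpleTransposition h.1, Finset.mem_insert, not_or] at this
        simpa [mul_assoc] using this.2
  induction w generalizing σ with
  | nil => exact fun j => j.elim0
  | cons a w ih =>
    have h0 : ∀ j : Fin w.length, (σ (leftPos a), σ (rightPos a)) ≠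
        ((σ * simpleTransposition a * wordProd (w.take j)) (leftPos (w.get j)),
        (σ * simpleTransposition a * wordProd (w.take j)) (rightPos (w.get j))) := by
      intro j he
      refine hnot w _ h.2 j ?_
      rw [← he, inversions_mul_simpleTransposition h.1]
      exact Finset.mem_insert_self _ _
    intro i j
    refine Fin.cases ?_ (fun i => ?_) i <;> refine Fin.cases ?_ (fun j => ?_) j
    · simp
    · intro he
      exact (h0 j (by simpa [mul_assoc] using he)).elim
    · intro he
      exact (h0 i (by simpa [mul_assoc] using he.symm)).elim
    · intro he
      rw [ih h.2 (a₁ := i) (a₂ := j) (by simpa [mul_assoc] using he)]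

/-! ### Transition operators -/

/-- Composition with `τ` on the right, as an operator on functions of a permutation. -/
noncomputable def shiftOp {n : ℕ} (τ : Equiv.Perm (Fin n)) :
    Module.End ℝ (Equiv.Perm (Fin n) → ℝ) :=
  LinearMap.funLeft ℝ ℝ fun π => π * τ

@[simp] theorem shiftOp_apply {n : ℕ} (τ : Equiv.Perm (Fin n)) (f : Equiv.Perm (Fin n) → ℝ)
    (π : Equiv.Perm (Fin n)) : shiftOp τ f π = f (π * τ) := rfl

theorem shiftOp_one {n : ℕ} : shiftOp (1 : Equiv.Perm (Fin n)) = 1 := by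
  ext f π
  simp

theorem shiftOp_mul {n : ℕ} (σ τ : Equiv.Perm (Fin n)) :
    shiftOp σ * shiftOp τ = shiftOp (σ * τ) := by
  ext f π
  simp [mul_assoc]

/-- The transition operator of a lazy transposition `T`: it sends `f` to `π ↦ 𝔼 f (π T)`. -/
noncomputable def stepOp {n : ℕ} (s : LazyParam n) : Module.End ℝ (Equiv.Perm (Fin n) → ℝ) :=
  (1 - s.p) • 1 + s.p • shiftOp (Equiv.swap s.a s.b)

/-- The transition operator of a sequence of lazy transpositions: it sends `f` to
`π ↦ 𝔼 f (π T₁ ⋯ T_ℓ)`. -/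
noncomputable def shuffleOp {n : ℕ} (S : List (LazyParam n)) :
    Module.End ℝ (Equiv.Perm (Fin n) → ℝ) :=
  (S.map stepOp).prod

theorem shuffleOp_nil_apply {n : ℕ} (f : Equiv.Perm (Fin n) → ℝ) (π : Equiv.Perm (Fin n)) :
    shuffleOp [] f π = f π := by
  simp [shuffleOp]

theorem shuffleOp_cons {n : ℕ} (s : LazyParam n) (S : List (LazyParam n)) :
    shuffleOp (s :: S) = stepOp s * shuffleOp S := by
  simp [shuffleOp]

theorem shuffleOp_cons_apply {n : ℕ} (s : LazyParam n) (S : List (LazyParam n))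
    (f : Equiv.Perm (Fin n) → ℝ) (π : Equiv.Perm (Fin n)) :
    shuffleOp (s :: S) f π =
      (1 - s.p) * shuffleOp S f π + s.p * shuffleOp S f (π * Equiv.swap s.a s.b) := by
  simp [shuffleOp, stepOp]

theorem map_mulLeft_apply {n : ℕ} (τ σ : Equiv.Perm (Fin n)) (μ : PMF (Equiv.Perm (Fin n))) :
    (μ.map fun π => τ * π) σ = μ (τ⁻¹ * σ) := by
  rw [PMF.map_apply, tsum_eq_single (τ⁻¹ * σ)]
  · simp
  · intro π hπ
    rw [if_neg]
    rintro rfl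
    simp at hπ

theorem compositionLaw_cons_apply {n : ℕ} (s : LazyParam n) (h : s.IsValid)
    (L : List (PMF (Equiv.Perm (Fin n)))) (σ : Equiv.Perm (Fin n)) :
    compositionLaw (lazyTransposition s h :: L) σ =
      ENNReal.ofReal s.p * compositionLaw L ((Equiv.swap s.a s.b)⁻¹ * σ) +
        ENNReal.ofReal (1 - s.p) * compositionLaw L σ := by
  rw [compositionLaw, lazyTransposition, PMF.bind_map, PMF.bind_apply, tsum_bool, add_comm,
    Function.comp_apply, Function.comp_apply, map_mulLeft_apply, map_mulLeft_apply]
  simp [biasedCoin]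

/-- The law of a composition is read off from the transition operator applied to an indicator. -/
theorem toReal_compositionLaw {n : ℕ} (S : List (LazyParam n)) (h : ∀ s ∈ S, s.IsValid)
    (σ π : Equiv.Perm (Fin n)) :
    (compositionLaw (S.pmap lazyTransposition h) (π⁻¹ * σ)).toReal =
      shuffleOp S (Pi.single σ 1) π := by
  induction S generalizing π with
  | nil =>
    rw [shuffleOp_nil_apply, List.pmap_nil, compositionLaw, PMF.pure_apply, Pi.single_apply]
    simp only [inv_mul_eq_one]
    split_ifs <;> simp
  | cons s S ih =>
    have hs := h s (by simp)
    rw [List.pmap_cons, compositionLaw_cons_apply, shuffleOp_cons_apply, ENNReal.toReal_add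
      (ENNReal.mul_ne_top ENNReal.ofReal_ne_top (PMF.apply_ne_top _ _))
      (ENNReal.mul_ne_top ENNReal.ofReal_ne_top (PMF.apply_ne_top _ _)),
      ENNReal.toReal_mul, ENNReal.toReal_mul, ENNReal.toReal_ofReal hs.2.1,
      ENNReal.toReal_ofReal (sub_nonneg.2 hs.2.2), ih, ← mul_assoc, ← mul_inv_rev, ih, add_comm]

/-- Under a transposition shuffle every expectation is the average over all permutations. -/
theorem IsTranspositionShuffle.shuffleOp_apply_one {n : ℕ} {S : List (LazyParam n)}
    (hS : IsTranspositionShuffle S) (f : Equiv.Perm (Fin n) → ℝ) :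
    shuffleOp S f 1 = (∑ σ, f σ) / (n.factorial : ℝ) := by
  obtain ⟨h, hlaw⟩ := hS
  have hsingle : ∀ σ : Equiv.Perm (Fin n),
      shuffleOp S (Pi.single σ 1) 1 = ((n.factorial : ℝ))⁻¹ := by
    intro σ
    rw [← toReal_compositionLaw S h, hlaw, PMF.uniformOfFintype_apply, Fintype.card_perm,
      Fintype.card_fin]
    simp
  have hf : f = ∑ σ, f σ • (Pi.single σ 1 : Equiv.Perm (Fin n) → ℝ) := by
    ext π
    simp [Finset.sum_apply, Pi.single_apply]
  conv_lhs => rw [hf, map_sum]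
  simp only [map_smul, Finset.sum_apply, Pi.smul_apply, hsingle, smul_eq_mul]
  rw [← Finset.sum_mul, div_eq_mul_inv]

/-- A permutation that the operator can reach is the product of a subword. -/
theorem exists_sublist_of_shuffleOp_ne_zero {n : ℕ} (w : List (Fin (n - 1))) (p : List ℝ)
    (f : Equiv.Perm (Fin n) → ℝ) (π : Equiv.Perm (Fin n))
    (h : shuffleOp (simpleParams w p) f π ≠ 0) :
    ∃ v, v.Sublist w ∧ f (π * wordProd v) ≠ 0 := by
  induction w generalizing p π with
  | nil => exact ⟨[], List.Sublist.refl _, by simpa [simpleParams, shuffleOp_nil_apply] using h⟩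
  | cons a w ih =>
    cases p with
    | nil => exact ⟨[], by simp, by simpa [simpleParams, shuffleOp_nil_apply] using h⟩
    | cons q p =>
      rw [simpleParams, List.zipWith_cons_cons, ← simpleParams, shuffleOp_cons_apply] at h
      by_cases h0 : shuffleOp (simpleParams w p) f π = 0
      · rw [h0, mul_zero, zero_add] at h
        obtain ⟨v, hv, hf⟩ := ih p _ (right_ne_zero_of_mul h)
        exact ⟨a :: v, hv.cons_cons a, by
          rwa [wordProd_cons, ← mul_assoc]⟩
      · obtain ⟨v, hv, hf⟩ := ih p _ h0
        exact ⟨v, hv.cons a, hf⟩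

theorem simpleParams_cons {n : ℕ} (a : Fin (n - 1)) (w : List (Fin (n - 1)))
    (p : Fin (w.length + 1) → ℝ) :
    simpleParams (a :: w) (List.ofFn p) =
      ⟨leftPos a, rightPos a, p 0⟩ :: simpleParams w (List.ofFn fun j => p j.succ) := by
  rw [List.ofFn_succ, simpleParams, List.zipWith_cons_cons, ← simpleParams]

theorem exists_word_of_simple {n : ℕ} (S : List (LazyParam n))
    (h : ∀ s ∈ S, (s.b : ℕ) = (s.a : ℕ) + 1) :
    ∃ (w : List (Fin (n - 1))) (p : Fin w.length → ℝ), S = simpleParams w (List.ofFn p) := by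
  induction S with
  | nil => exact ⟨[], Fin.elim0, rfl⟩
  | cons s S ih =>
    obtain ⟨w, p, rfl⟩ := ih fun t ht => h t (List.mem_cons_of_mem _ ht)
    have hs := h s List.mem_cons_self
    refine ⟨⟨s.a, by omega⟩ :: w, Fin.cons s.p p, ?_⟩
    rw [simpleParams_cons]
    congr 1
    ext
    · rfl
    · exact hs
    · rfl

theorem length_simpleParams {n : ℕ} (w : List (Fin (n - 1))) (p : Fin w.length → ℝ) :
    (simpleParams w (List.ofFn p)).length = w.length := by
  simp [simpleParams]

theorem IsTranspositionShuffle.exists_sublist {n : ℕ} {w : List (Fin (n - 1))} {p : List ℝ}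
    (h : IsTranspositionShuffle (simpleParams w p)) :
    ∃ v, v.Sublist w ∧ wordProd v = Fin.revPerm := by
  obtain ⟨v, hv, hf⟩ := exists_sublist_of_shuffleOp_ne_zero w p (Pi.single Fin.revPerm 1) 1 (by
    rw [h.shuffleOp_apply_one]
    simp [Nat.factorial_ne_zero])
  refine ⟨v, hv, ?_⟩
  by_contra hne
  rw [one_mul, Pi.single_eq_of_ne hne] at hf
  exact hf rfl

theorem IsTranspositionShuffle.choose_two_le_length {n : ℕ} {w : List (Fin (n - 1))} {p : List ℝ}
    (h : IsTranspositionShuffle (simpleParams w p)) : n.choose 2 ≤ w.length := by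
  obtain ⟨v, hv, hrev⟩ := h.exists_sublist
  exact (_root_.choose_two_le_length hrev).trans hv.length_le

theorem IsTranspositionShuffle.isReducedWord {n : ℕ} {w : List (Fin (n - 1))} {p : List ℝ}
    (h : IsTranspositionShuffle (simpleParams w p)) (hl : w.length = n.choose 2) :
    IsReducedWord w := by
  obtain ⟨v, hv, hrev⟩ := h.exists_sublist
  refine ⟨hl, ?_⟩
  rwa [← hv.eq_of_length_le (hl ▸ _root_.choose_two_le_length hrev)]

/-! ### Shuffles are detected by invariance -/

theorem mem_closure_simpleTransposition {n : ℕ} (σ : Equiv.Perm (Fin n)) :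
    σ ∈ Submonoid.closure (Set.range (simpleTransposition (n := n))) := by
  obtain _ | n := n
  · rw [Subsingleton.elim σ 1]
    exact one_mem _
  · have := Equiv.Perm.mclosure_swap_castSucc_succ n
    have h2 : Set.range (simpleTransposition (n := n + 1)) =
      Set.range fun i : Fin n => Equiv.swap i.castSucc i.succ := rfl
    rw [h2, this]
    trivial

/-- Admissible parameters give a transposition shuffle as soon as a further transposition of any
adjacent pair does not change the outcome in law. -/
theorem isTranspositionShuffle_of_mul_shiftOp {n : ℕ} {S : List (LazyParam n)}
    (h : ∀ s ∈ S, s.IsValid)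
    (hinv : ∀ b : Fin (n - 1), shuffleOp S * shiftOp (simpleTransposition b) = shuffleOp S) :
    IsTranspositionShuffle S := by
  have hall : ∀ τ : Equiv.Perm (Fin n), shuffleOp S * shiftOp τ = shuffleOp S := by
    intro τ
    induction mem_closure_simpleTransposition τ using Submonoid.closure_induction with
    | mem x hx =>
      obtain ⟨b, rfl⟩ := hx
      exact hinv b
    | one => rw [shiftOp_one, mul_one]
    | mul x y _ _ hx hy => rw [← shiftOp_mul, ← mul_assoc, hx, hy]
  set μ := compositionLaw (S.pmap lazyTransposition h) with hμ
  have hconst : ∀ σ, μ σ = μ 1 := by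
    intro σ
    rw [← ENNReal.toReal_eq_toReal_iff' (PMF.apply_ne_top _ _) (PMF.apply_ne_top _ _)]
    have h1 := toReal_compositionLaw S h σ 1
    have h2 := toReal_compositionLaw S h 1 1
    rw [inv_one, one_mul, ← hμ] at h1 h2
    rw [h1, h2, ← hall σ]
    have : shiftOp σ (Pi.single σ 1) = Pi.single 1 1 := by
      ext π
      simp [Pi.single_apply]
    rw [Module.End.mul_apply, this, hall σ]
  refine ⟨h, ?_⟩
  have hsum := μ.tsum_coe
  rw [tsum_fintype, Finset.sum_congr rfl fun σ _ => hconst σ, Finset.sum_const, nsmul_eq_mul,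
    Finset.card_univ] at hsum
  ext σ
  rw [← hμ, hconst, PMF.uniformOfFintype_apply]
  exact ENNReal.eq_inv_of_mul_eq_one_left (by rwa [mul_comm])

/-! ### Yang–Baxter exchange -/

/-- The Yang–Baxter equation for two involutions that satisfy the braid relation. -/
theorem yangBaxter {A : Type*} [Ring A] [Algebra ℝ A] {s t : A} (hs : s * s = 1) (ht : t * t = 1)
    (hst : s * t * s = t * s * t) (x y : ℝ) :
    (1 + x • s) * (1 + (x + y) • t) * (1 + y • s) =
      (1 + y • t) * (1 + (x + y) • s) * (1 + x • t) := by
  simp only [add_mul, mul_add, one_mul, mul_one, smul_mul_assoc, mul_smul_comm, hs, ht, hst]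
  module

/-- The operator `1 + d t(a)`: a multiple of the transition operator of the lazy transposition of
`a` and `a + 1` with probability `d / (d + 1)`. -/
noncomputable def crossingOp {n : ℕ} (a : Fin (n - 1)) (d : ℝ) :
    Module.End ℝ (Equiv.Perm (Fin n) → ℝ) :=
  1 + d • shiftOp (simpleTransposition a)

theorem shiftOp_simpleTransposition_mul_self {n : ℕ} (a : Fin (n - 1)) :
    shiftOp (simpleTransposition a) * shiftOp (simpleTransposition a) = 1 := by
  rw [shiftOp_mul, simpleTransposition_mul_self, shiftOp_one]

theorem crossingOp_comm {n : ℕ} {a b : Fin (n - 1)} (h : Commute (simpleTransposition a)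
    (simpleTransposition b)) (x y : ℝ) :
    crossingOp a x * crossingOp b y = crossingOp b y * crossingOp a x := by
  have : shiftOp (simpleTransposition a) * shiftOp (simpleTransposition b) =
      shiftOp (simpleTransposition b) * shiftOp (simpleTransposition a) := by
    rw [shiftOp_mul, shiftOp_mul, h.eq]
  simp only [crossingOp, add_mul, mul_add, one_mul, mul_one, smul_mul_assoc, mul_smul_comm, this]
  module

theorem crossingOp_yangBaxter {n : ℕ} {a b : Fin (n - 1)}
    (h : simpleTransposition a * simpleTransposition b * simpleTransposition a =
      simpleTransposition b * simpleTransposition a * simpleTransposition b) (x y : ℝ) :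
    crossingOp a x * crossingOp b (x + y) * crossingOp a y =
      crossingOp b y * crossingOp a (x + y) * crossingOp b x :=
  yangBaxter (shiftOp_simpleTransposition_mul_self a) (shiftOp_simpleTransposition_mul_self b)
    (by simp only [shiftOp_mul, h]) x y

theorem simpleTransposition_braid {n : ℕ} {a b : Fin (n - 1)} (h : rightPos a = leftPos b) :
    simpleTransposition a * simpleTransposition b * simpleTransposition a =
      simpleTransposition b * simpleTransposition a * simpleTransposition b := by
  have h1 := leftPos_lt_rightPos a
  have h2 := leftPos_lt_rightPos b
  have h3 : leftPos a < rightPos b := h1.trans (h ▸ h2)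
  unfold simpleTransposition
  rw [h] at h1 ⊢
  rw [Equiv.swap_mul_swap_mul_swap h1.ne h3.ne, Equiv.swap_comm (leftPos a) (leftPos b),
    Equiv.swap_comm (leftPos b) (rightPos b), Equiv.swap_mul_swap_mul_swap h2.ne' h3.ne',
    Equiv.swap_comm]

theorem simpleTransposition_apply_of_ne {n : ℕ} {a : Fin (n - 1)} {i : Fin n}
    (h1 : i ≠ leftPos a) (h2 : i ≠ rightPos a) : simpleTransposition a i = i :=
  Equiv.swap_apply_of_ne_of_ne h1 h2

/-- `IsCrossingProduct k σ F` says that `F` is the product of the operators `1 + (v - u) t(a)`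
along an ascending word of length `k` from the identity to `σ`, where `a` runs over the letters of
the word and `u < v` are the elements that the letter transposes. -/
inductive IsCrossingProduct {n : ℕ} :
    ℕ → Equiv.Perm (Fin n) → Module.End ℝ (Equiv.Perm (Fin n) → ℝ) → Prop
  | one : IsCrossingProduct 0 1 1
  | mul {k : ℕ} {σ : Equiv.Perm (Fin n)} {F : Module.End ℝ (Equiv.Perm (Fin n) → ℝ)}
      (h : IsCrossingProduct k σ F) (a : Fin (n - 1)) (ha : σ (leftPos a) < σ (rightPos a)) :
      IsCrossingProduct (k + 1) (σ * simpleTransposition a)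
        (F * crossingOp a ((σ (rightPos a) : ℕ) - (σ (leftPos a) : ℕ) : ℝ))

/-- Appending a factor, with the new permutation and the new weight given up to equality. -/
theorem IsCrossingProduct.mul_of_eq {n k : ℕ} {σ τ : Equiv.Perm (Fin n)}
    {F : Module.End ℝ (Equiv.Perm (Fin n) → ℝ)} (h : IsCrossingProduct k σ F) (a : Fin (n - 1))
    {i j : Fin n} (hi : σ (leftPos a) = i) (hj : σ (rightPos a) = j) (hij : i < j)
    (hτ : σ * simpleTransposition a = τ) :
    IsCrossingProduct (k + 1) τ (F * crossingOp a ((j : ℕ) - (i : ℕ) : ℝ)) := by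
  subst hi hj hτ
  exact h.mul a hij

/-- The exchange property: a product of crossing operators that leads to `σ` may be rewritten so
that its last factor belongs to any given descent of `σ`. This takes the commutation relations when
the descent is away from the last letter and the Yang–Baxter equation when it is next to it. -/
theorem IsCrossingProduct.exchange {n : ℕ} (k : ℕ) {σ : Equiv.Perm (Fin n)}
    {F : Module.End ℝ (Equiv.Perm (Fin n) → ℝ)} (h : IsCrossingProduct (k + 1) σ F)
    (b : Fin (n - 1)) (hb : σ (rightPos b) < σ (leftPos b)) :
    ∃ F', IsCrossingProduct k (σ * simpleTransposition b) F' ∧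
      F = F' * crossingOp b ((σ (leftPos b) : ℕ) - (σ (rightPos b) : ℕ) : ℝ) := by
  induction k using Nat.strong_induction_on generalizing σ F b with
  | _ k ih =>
  cases h with
  | @mul _ σ G h a ha =>
  have hl := leftPos_lt_rightPos a
  have hl' := leftPos_lt_rightPos b
  by_cases hab : a = b
  · subst hab
    refine ⟨G, by rwa [mul_assoc, simpleTransposition_mul_self, mul_one], ?_⟩
    simp [simpleTransposition_leftPos, simpleTransposition_rightPos]
  -- The identity has no descent, so the remaining word is not empty.
  have hpos : ∀ {m : ℕ} {ρ : Equiv.Perm (Fin n)} {H}, IsCrossingProduct m ρ H →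
      ∀ c, ρ (rightPos c) < ρ (leftPos c) → ∃ m', m = m' + 1 := by
    intro m ρ H hH c hc
    cases hH with
    | one => exact absurd hc (leftPos_lt_rightPos c).not_gt
    | mul => exact ⟨_, rfl⟩
  by_cases hadj : rightPos a = leftPos b
  · have hne : rightPos b ≠ leftPos a := (hl.trans (hadj ▸ hl')).ne'
    have hne' : rightPos b ≠ rightPos a := (hadj ▸ hl').ne'
    have e1 : (σ * simpleTransposition a) (leftPos b) = σ (leftPos a) := by
      rw [Equiv.Perm.mul_apply, ← hadj, simpleTransposition_rightPos]
    have e2 : (σ * simpleTransposition a) (rightPos b) = σ (rightPos b) := by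
      rw [Equiv.Perm.mul_apply, simpleTransposition_apply_of_ne hne hne']
    have e3 : (σ * simpleTransposition b) (leftPos a) = σ (leftPos a) := by
      rw [Equiv.Perm.mul_apply, simpleTransposition_apply_of_ne (hadj ▸ hl).ne hne.symm]
    have e4 : (σ * simpleTransposition b) (rightPos a) = σ (rightPos b) := by
      rw [Equiv.Perm.mul_apply, hadj, simpleTransposition_leftPos]
    rw [e1, e2] at hb ⊢
    have hd1 : σ (rightPos b) < σ (leftPos b) := hadj ▸ hb.trans ha
    obtain ⟨m, rfl⟩ := hpos h b hd1
    obtain ⟨G1, h1, rfl⟩ := ih m (by omega) h b hd1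
    have hd2 : (σ * simpleTransposition b) (rightPos a) <
        (σ * simpleTransposition b) (leftPos a) := by rwa [e3, e4]
    obtain ⟨m, rfl⟩ := hpos h1 a hd2
    obtain ⟨G2, h2, rfl⟩ := ih m (by omega) h1 a hd2
    rw [e3, e4]
    have hbraid := simpleTransposition_braid hadj
    refine ⟨_, ((h2.mul_of_eq b (i := σ (leftPos a)) (j := σ (rightPos a)) ?_ ?_ ha rfl).mul_of_eq a
      (i := σ (rightPos b)) (j := σ (rightPos a)) ?_ ?_ (hb.trans ha) ?_), ?_⟩
    · rw [Equiv.Perm.mul_apply, ← hadj, simpleTransposition_rightPos, e3]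
    · rw [Equiv.Perm.mul_apply, simpleTransposition_apply_of_ne hne hne', Equiv.Perm.mul_apply,
        simpleTransposition_rightPos, hadj]
    · rw [Equiv.Perm.mul_apply, simpleTransposition_apply_of_ne (hadj ▸ hl).ne hne.symm,
        Equiv.Perm.mul_apply, simpleTransposition_leftPos, e4]
    · rw [Equiv.Perm.mul_apply, hadj, simpleTransposition_leftPos, Equiv.Perm.mul_apply,
        simpleTransposition_apply_of_ne hne hne', Equiv.Perm.mul_apply,
        simpleTransposition_rightPos]
    · calc _ = σ * (simpleTransposition b * simpleTransposition a * simpleTransposition b) *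
            simpleTransposition a := by simp only [mul_assoc]
        _ = σ * simpleTransposition a * simpleTransposition b := by
            rw [← hbraid]
            simp only [mul_assoc, simpleTransposition_mul_self, mul_one]
    · have hyb := crossingOp_yangBaxter hbraid
        ((σ (leftPos a) : ℕ) - (σ (rightPos b) : ℕ) : ℝ)
        ((σ (rightPos a) : ℕ) - (σ (leftPos a) : ℕ) : ℝ)
      have hsum : ((σ (leftPos a) : ℕ) - (σ (rightPos b) : ℕ) : ℝ) +
        ((σ (rightPos a) : ℕ) - (σ (leftPos a) : ℕ) : ℝ) =
          ((σ (rightPos a) : ℕ) - (σ (rightPos b) : ℕ) : ℝ) := by ring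
      rw [hsum] at hyb
      simp only [mul_assoc, ← hadj] at hyb ⊢
      rw [hyb]
  by_cases hadj' : rightPos b = leftPos a
  · have hne : leftPos b ≠ leftPos a := (hadj' ▸ hl').ne
    have hne' : leftPos b ≠ rightPos a := (hl'.trans (hadj' ▸ hl)).ne
    have e1 : (σ * simpleTransposition a) (leftPos b) = σ (leftPos b) := by
      rw [Equiv.Perm.mul_apply, simpleTransposition_apply_of_ne hne hne']
    have e2 : (σ * simpleTransposition a) (rightPos b) = σ (rightPos a) := by
      rw [Equiv.Perm.mul_apply, hadj', simpleTransposition_leftPos]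
    have e3 : (σ * simpleTransposition b) (leftPos a) = σ (leftPos b) := by
      rw [Equiv.Perm.mul_apply, ← hadj', simpleTransposition_rightPos]
    have e4 : (σ * simpleTransposition b) (rightPos a) = σ (rightPos a) := by
      rw [Equiv.Perm.mul_apply, simpleTransposition_apply_of_ne hne'.symm (hadj' ▸ hl).ne']
    rw [e1, e2] at hb ⊢
    have hd1 : σ (rightPos b) < σ (leftPos b) := hadj' ▸ ha.trans hb
    obtain ⟨m, rfl⟩ := hpos h b hd1
    obtain ⟨G1, h1, rfl⟩ := ih m (by omega) h b hd1
    have hd2 : (σ * simpleTransposition b) (rightPos a) <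
        (σ * simpleTransposition b) (leftPos a) := by rwa [e3, e4]
    obtain ⟨m, rfl⟩ := hpos h1 a hd2
    obtain ⟨G2, h2, rfl⟩ := ih m (by omega) h1 a hd2
    rw [e3, e4]
    have hbraid := (simpleTransposition_braid hadj').symm
    refine ⟨_, ((h2.mul_of_eq b (i := σ (leftPos a)) (j := σ (rightPos a)) ?_ ?_ ha rfl).mul_of_eq a
      (i := σ (leftPos a)) (j := σ (leftPos b)) ?_ ?_ (ha.trans hb) ?_), ?_⟩
    · rw [Equiv.Perm.mul_apply, simpleTransposition_apply_of_ne hne hne', Equiv.Perm.mul_apply,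
        simpleTransposition_leftPos, hadj']
    · rw [Equiv.Perm.mul_apply, hadj', simpleTransposition_leftPos, e4]
    · rw [Equiv.Perm.mul_apply, ← hadj', simpleTransposition_rightPos, Equiv.Perm.mul_apply,
        simpleTransposition_apply_of_ne hne hne', Equiv.Perm.mul_apply,
        simpleTransposition_leftPos, hadj']
    · rw [Equiv.Perm.mul_apply, simpleTransposition_apply_of_ne hne'.symm (hadj' ▸ hl).ne',
        Equiv.Perm.mul_apply, simpleTransposition_rightPos, e3]
    · calc _ = σ * (simpleTransposition b * simpleTransposition a * simpleTransposition b) *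
            simpleTransposition a := by simp only [mul_assoc]
        _ = σ * simpleTransposition a * simpleTransposition b := by
            rw [← hbraid]
            simp only [mul_assoc, simpleTransposition_mul_self, mul_one]
    · have hyb := crossingOp_yangBaxter hbraid
        ((σ (leftPos b) : ℕ) - (σ (rightPos a) : ℕ) : ℝ)
        ((σ (rightPos a) : ℕ) - (σ (leftPos a) : ℕ) : ℝ)
      have hsum : ((σ (leftPos b) : ℕ) - (σ (rightPos a) : ℕ) : ℝ) +
        ((σ (rightPos a) : ℕ) - (σ (leftPos a) : ℕ) : ℝ) =
          ((σ (leftPos b) : ℕ) - (σ (leftPos a) : ℕ) : ℝ) := by ring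
      rw [hsum] at hyb
      simp only [mul_assoc, hadj'] at hyb ⊢
      rw [hyb]
  -- The two letters share no position.
  have hne1 : leftPos b ≠ leftPos a := fun e => hab (by
    ext
    have := congrArg Fin.val e
    simp only [leftPos] at this
    omega)
  have hne2 : rightPos b ≠ rightPos a := fun e => hab (by
    ext
    have := congrArg Fin.val e
    simp only [rightPos] at this
    omega)
  have hne3 : leftPos b ≠ rightPos a := Ne.symm hadj
  have hcomm : Commute (simpleTransposition a) (simpleTransposition b) :=
    (Equiv.Perm.disjoint_swap_swap (by simp; grind)).commute
  have e1 : (σ * simpleTransposition a) (leftPos b) = σ (leftPos b) := by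
    rw [Equiv.Perm.mul_apply, simpleTransposition_apply_of_ne hne1 hne3]
  have e2 : (σ * simpleTransposition a) (rightPos b) = σ (rightPos b) := by
    rw [Equiv.Perm.mul_apply, simpleTransposition_apply_of_ne hadj' hne2]
  rw [e1, e2] at hb ⊢
  obtain ⟨m, rfl⟩ := hpos h b hb
  obtain ⟨G1, h1, rfl⟩ := ih m (by omega) h b hb
  refine ⟨_, h1.mul_of_eq a (i := σ (leftPos a)) (j := σ (rightPos a)) ?_ ?_ ha ?_, ?_⟩
  · rw [Equiv.Perm.mul_apply, simpleTransposition_apply_of_ne hne1.symm (Ne.symm hadj')]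
  · rw [Equiv.Perm.mul_apply, simpleTransposition_apply_of_ne hne3.symm hne2.symm]
  · rw [mul_assoc, mul_assoc, hcomm.eq]
  · rw [mul_assoc, mul_assoc, crossingOp_comm hcomm]

theorem crossingOp_one_mul_shiftOp {n : ℕ} (b : Fin (n - 1)) :
    crossingOp b 1 * shiftOp (simpleTransposition b) = crossingOp b 1 := by
  rw [crossingOp, one_smul, add_mul, one_mul, shiftOp_simpleTransposition_mul_self, add_comm]

/-- At the reverse permutation every descent has weight one, so that the product absorbs every
simple transposition. -/
theorem IsCrossingProduct.mul_shiftOp {n k : ℕ} {F : Module.End ℝ (Equiv.Perm (Fin n) → ℝ)}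
    (h : IsCrossingProduct k Fin.revPerm F) (b : Fin (n - 1)) :
    F * shiftOp (simpleTransposition b) = F := by
  have hb : (Fin.revPerm : Equiv.Perm (Fin n)) (rightPos b) < Fin.revPerm (leftPos b) := by
    simpa using leftPos_lt_rightPos b
  generalize hρ : (Fin.revPerm : Equiv.Perm (Fin n)) = ρ at h hb
  cases k with
  | zero =>
    cases h
    exact absurd hb (leftPos_lt_rightPos b).not_gt
  | succ k =>
    obtain ⟨F', -, rfl⟩ := h.exchange k b hb
    have hone : ((ρ (leftPos b) : ℕ) - (ρ (rightPos b) : ℕ) : ℝ) = 1 := by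
      rw [← Nat.cast_sub hb.le, ← hρ]
      have := b.isLt
      simp only [Fin.revPerm_apply, Fin.val_rev, leftPos, rightPos, Nat.cast_eq_one]
      omega
    rw [hone, mul_assoc, crossingOp_one_mul_shiftOp]

/-! ### The construction is a shuffle -/

theorem stepOp_eq_smul_crossingOp {n : ℕ} (a : Fin (n - 1)) {d : ℝ} (hd : d + 1 ≠ 0) :
    stepOp ⟨leftPos a, rightPos a, d / (d + 1)⟩ = (d + 1)⁻¹ • crossingOp a d := by
  have h1 : 1 - d / (d + 1) = (d + 1)⁻¹ := by
    field_simp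
    ring
  rw [stepOp, crossingOp, simpleTransposition, smul_add, smul_smul, h1, div_eq_inv_mul]

theorem AscendingFrom.exists_isCrossingProduct {n : ℕ} (w : List (Fin (n - 1)))
    (σ : Equiv.Perm (Fin n)) (hw : AscendingFrom σ w) (k : ℕ)
    (F : Module.End ℝ (Equiv.Perm (Fin n) → ℝ)) (hF : IsCrossingProduct k σ F) :
    ∃ (c : ℝ) (k' : ℕ) (G : Module.End ℝ (Equiv.Perm (Fin n) → ℝ)),
      IsCrossingProduct k' (σ * wordProd w) G ∧
      F * shuffleOp (simpleParams w (List.ofFn fun j : Fin w.length =>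
        ((((σ * wordProd (w.take j)) (rightPos (w.get j)) : ℕ) : ℝ) -
          (((σ * wordProd (w.take j)) (leftPos (w.get j)) : ℕ) : ℝ)) /
        ((((σ * wordProd (w.take j)) (rightPos (w.get j)) : ℕ) : ℝ) -
          (((σ * wordProd (w.take j)) (leftPos (w.get j)) : ℕ) : ℝ) + 1))) = c • G := by
  induction w generalizing σ k F with
  | nil => exact ⟨1, k, F, by simpa using hF, by simp [simpleParams, shuffleOp]⟩
  | cons a w ih =>
    obtain ⟨c, k', G, hG, hc⟩ := ih _ hw.2 _ _ (hF.mul a hw.1)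
    refine ⟨((σ (rightPos a) : ℕ) - (σ (leftPos a) : ℕ) + 1 : ℝ)⁻¹ * c, k', G,
      by rwa [wordProd_cons, ← mul_assoc], ?_⟩
    have hpos : ((σ (rightPos a) : ℕ) - (σ (leftPos a) : ℕ) + 1 : ℝ) ≠ 0 := by
      have : ((σ (leftPos a) : ℕ) : ℝ) < (σ (rightPos a) : ℕ) := by exact_mod_cast hw.1
      linarith
    rw [mul_smul, ← hc, simpleParams_cons, shuffleOp_cons]
    simp only [List.get_eq_getElem, Fin.val_zero, List.take_zero, wordProd_nil, mul_one,
      List.getElem_cons_zero, Fin.val_succ, List.take_succ_cons, wordProd_cons,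
      List.getElem_cons_succ, ← mul_assoc]
    rw [stepOp_eq_smul_crossingOp a hpos, mul_smul_comm, smul_mul_assoc]

theorem construction_eq {n : ℕ} (w : List (Fin (n - 1))) :
    construction w = simpleParams w (List.ofFn fun j : Fin w.length =>
      (((rightElement w j : ℕ) : ℝ) - ((leftElement w j : ℕ) : ℝ)) /
        (((rightElement w j : ℕ) : ℝ) - ((leftElement w j : ℕ) : ℝ) + 1)) := rfl

theorem mem_simpleParams {n : ℕ} {w : List (Fin (n - 1))} {p : Fin w.length → ℝ}
    {s : LazyParam n} (h : s ∈ simpleParams w (List.ofFn p)) :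
    ∃ j : Fin w.length, s = ⟨leftPos (w.get j), rightPos (w.get j), p j⟩ := by
  obtain ⟨i, hi, rfl⟩ := List.mem_iff_getElem.1 h
  rw [length_simpleParams] at hi
  exact ⟨⟨i, hi⟩, by simp [simpleParams]⟩

theorem IsReducedWord.isSimpleTranspositionShuffle_construction {n : ℕ}
    {w : List (Fin (n - 1))} (hw : IsReducedWord w) :
    IsSimpleTranspositionShuffle (construction w) := by
  rw [construction_eq]
  refine ⟨isTranspositionShuffle_of_mul_shiftOp ?_ ?_, ?_⟩
  · intro s hs
    obtain ⟨j, rfl⟩ := mem_simpleParams hs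
    have hlt : ((leftElement w j : ℕ) : ℝ) < (rightElement w j : ℕ) := by
      exact_mod_cast hw.leftElement_lt_rightElement j
    refine ⟨(leftPos_lt_rightPos _).ne, div_nonneg ?_ ?_, (div_le_one ?_).2 ?_⟩ <;> linarith
  · intro b
    obtain ⟨c, k, G, hG, hc⟩ := hw.ascendingFrom_one.exists_isCrossingProduct w 1 0 1 .one
    rw [one_mul, hw.2] at hG
    simp only [one_mul] at hc
    simp only [leftElement, rightElement]
    rw [hc, smul_mul_assoc, hG.mul_shiftOp]
  · intro s hs
    obtain ⟨j, rfl⟩ := mem_simpleParams hs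
    rfl

/-! ### The probabilities are determined -/

/-- `π` lags behind `σ` on the set `L` of elements: the least element that the two place differently
belongs to `L`, and `π` places it further to the left. -/
def Lags {α : Type*} [LinearOrder α] (L : α → Prop) (σ π : Equiv.Perm α) : Prop :=
  ∃ x, L x ∧ (∀ y < x, σ⁻¹ y = π⁻¹ y) ∧ π⁻¹ x < σ⁻¹ x

theorem swap_lt_swap_of_covBy {α : Type*} [LinearOrder α] {i j x y : α} (hij : i ⋖ j) (h : x < y)
    (hne : ¬ (x = i ∧ y = j)) : Equiv.swap i j x < Equiv.swap i j y := by
  have hlt := hij.lt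
  have hx := fun h1 => hij.2 (c := x) h1
  have hy := fun h1 => hij.2 (c := y) h1
  simp only [Equiv.swap_apply_def]
  clear hij
  split_ifs <;> grind

theorem inv_mul_swap_apply {α : Type*} [DecidableEq α] (σ : Equiv.Perm α) (i j x : α) :
    (σ * Equiv.swap i j)⁻¹ x = Equiv.swap i j (σ⁻¹ x) := by
  rw [mul_inv_rev, Equiv.swap_inv, Equiv.Perm.mul_apply]

theorem inv_apply_ne {α : Type*} (σ : Equiv.Perm α) {i x : α} (h : x ≠ σ i) : σ⁻¹ x ≠ i :=
  fun e => h (Equiv.Perm.inv_eq_iff_eq.1 e)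

theorem inv_apply_apply {α : Type*} (σ : Equiv.Perm α) (i : α) : σ⁻¹ (σ i) = i :=
  Equiv.Perm.inv_eq_iff_eq.2 rfl

/-- A lag persists when both permutations are multiplied by an ascending simple transposition. -/
theorem Lags.mul_swap {α : Type*} [LinearOrder α] {L : α → Prop} {σ π : Equiv.Perm α}
    (h : Lags L σ π) {i j : α} (hij : i ⋖ j) (hσ : σ i < σ j) :
    Lags L (σ * Equiv.swap i j) (π * Equiv.swap i j) := by
  obtain ⟨x, hx, hagree, hlt⟩ := h
  refine ⟨x, hx, fun y hy => ?_, ?_⟩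
  · rw [inv_mul_swap_apply, inv_mul_swap_apply, hagree y hy]
  · rw [inv_mul_swap_apply, inv_mul_swap_apply]
    refine swap_lt_swap_of_covBy hij hlt ?_
    rintro ⟨h1, h2⟩
    -- Otherwise `σ i < x = σ j` would be at place `i` in both permutations, where `π` has `x`.
    have hxj : x = σ j := Equiv.Perm.inv_eq_iff_eq.1 h2
    have hi := hagree (σ i) (hxj ▸ hσ)
    rw [inv_apply_apply] at hi
    exact hσ.ne ((π⁻¹.injective (h1.trans hi)).symm.trans hxj)

/-- A permutation starts to lag when it skips an ascending simple transposition whose smaller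
element belongs to `L`. -/
theorem lags_mul_swap_of_agree {α : Type*} [LinearOrder α] {L : α → Prop} {σ π : Equiv.Perm α}
    {i j : α} (hij : i < j) (hσ : σ i < σ j) (hL : L (σ i)) (h : ∀ y ≤ σ i, σ⁻¹ y = π⁻¹ y) :
    Lags L (σ * Equiv.swap i j) π := by
  refine ⟨σ i, hL, fun y hy => ?_, ?_⟩
  · rw [inv_mul_swap_apply, Equiv.swap_apply_of_ne_of_ne (inv_apply_ne σ hy.ne)
      (inv_apply_ne σ (hy.trans hσ).ne), h y hy.le]
  · rwa [inv_mul_swap_apply, ← h _ le_rfl, inv_apply_apply, Equiv.swap_apply_left]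

/-- A lag persists when the lagging permutation skips an ascending simple transposition. -/
theorem Lags.mul_swap_left {α : Type*} [LinearOrder α] {L : α → Prop}
    (hL : ∀ x y, y < x → L x → L y) {σ π : Equiv.Perm α}
    (h : Lags L σ π) {i j : α} (hij : i ⋖ j) (hσ : σ i < σ j) :
    Lags L (σ * Equiv.swap i j) π := by
  obtain ⟨x, hx, hagree, hlt⟩ := h
  rcases lt_or_ge (σ i) x with hix | hix
  · exact lags_mul_swap_of_agree hij.lt hσ (hL _ _ hix hx) fun y hy => hagree y (hy.trans_lt hix)
  · refine ⟨x, hx, fun y hy => ?_, ?_⟩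
    · rw [inv_mul_swap_apply, Equiv.swap_apply_of_ne_of_ne (inv_apply_ne σ (hy.trans_le hix).ne)
        (inv_apply_ne σ ((hy.trans_le hix).trans hσ).ne), hagree y hy]
    · rw [inv_mul_swap_apply]
      have hj : σ⁻¹ x ≠ j := inv_apply_ne σ (hix.trans_lt hσ).ne
      by_cases hi : σ⁻¹ x = i
      · rw [hi, Equiv.swap_apply_left]
        exact hlt.trans (hi ▸ hij.lt)
      · rwa [Equiv.swap_apply_of_ne_of_ne hi hj]

/-- `π` has gone astray from `σ` outside the interval of elements from `lo` to `hi`: it lags behind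
`σ` on the elements below `lo`, or, with the orders of elements and of positions both reversed, on
the elements above `hi`. -/
def Astray {n : ℕ} (lo hi : ℕ) (σ π : Equiv.Perm (Fin n)) : Prop :=
  Lags (fun x : Fin n => (x : ℕ) < lo) σ π ∨
    @Lags (Fin n) (OrderDual.instLinearOrder (Fin n)) (fun x : Fin n => hi < (x : ℕ)) σ π

/-- `π` agrees with `σ` outside the interval from `lo` to `hi`: it places all elements below `lo` or
above `hi` as `σ` does. -/
def AgreeOutside {n : ℕ} (lo hi : ℕ) (σ π : Equiv.Perm (Fin n)) : Prop :=
  ∀ x : Fin n, (x : ℕ) < lo ∨ hi < (x : ℕ) → σ⁻¹ x = π⁻¹ x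

theorem Astray.not_agreeOutside {n lo hi : ℕ} {σ π : Equiv.Perm (Fin n)}
    (h : Astray lo hi σ π) : ¬ AgreeOutside lo hi σ π := by
  rintro hag
  rcases h with ⟨x, hx, -, hlt⟩ | ⟨x, hx, -, hlt⟩
  · exact (hag x (.inl hx)).not_gt hlt
  · exact absurd (hag x (.inr hx)) (ne_of_gt (α := Fin n) (show σ⁻¹ x < π⁻¹ x from hlt)).symm

theorem covBy_dual {n : ℕ} (a : Fin (n - 1)) :
    @CovBy (Fin n) (OrderDual.instLinearOrder (Fin n)).toLT (rightPos a) (leftPos a) :=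
  ⟨leftPos_lt_rightPos a, fun c h1 h2 => (leftPos_covBy_rightPos a).2
    (show leftPos a < c from h2) (show c < rightPos a from h1)⟩

theorem Astray.mul_simpleTransposition {n lo hi : ℕ} {σ π : Equiv.Perm (Fin n)}
    (h : Astray lo hi σ π) {a : Fin (n - 1)} (ha : σ (leftPos a) < σ (rightPos a)) :
    Astray lo hi (σ * simpleTransposition a) (π * simpleTransposition a) := by
  rcases h with h | h
  · exact .inl (h.mul_swap (leftPos_covBy_rightPos a) ha)
  · have := @Lags.mul_swap (Fin n) (OrderDual.instLinearOrder (Fin n)) _ _ _ h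
      (rightPos a) (leftPos a) (covBy_dual a) ha
    right
    rw [simpleTransposition, Equiv.swap_comm]
    convert this

theorem Astray.mul_simpleTransposition_left {n lo hi : ℕ} {σ π : Equiv.Perm (Fin n)}
    (h : Astray lo hi σ π) {a : Fin (n - 1)} (ha : σ (leftPos a) < σ (rightPos a)) :
    Astray lo hi (σ * simpleTransposition a) π := by
  rcases h with h | h
  · exact .inl (h.mul_swap_left (fun (x y : Fin n) (hxy : y < x) (hx : (x : ℕ) < lo) =>
      lt_trans (Fin.lt_def.1 hxy) hx) (leftPos_covBy_rightPos a) ha)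
  · have := @Lags.mul_swap_left (Fin n) (OrderDual.instLinearOrder (Fin n)) _
      (fun x y (hxy : x < y) (hx : hi < (x : ℕ)) => lt_trans hx hxy) _ _ h
      (rightPos a) (leftPos a) (covBy_dual a) ha
    right
    rw [simpleTransposition, Equiv.swap_comm]
    convert this

theorem AgreeOutside.astray {n lo hi : ℕ} {σ π : Equiv.Perm (Fin n)}
    (h : AgreeOutside lo hi σ π) {a : Fin (n - 1)} (ha : σ (leftPos a) < σ (rightPos a))
    (hout : ¬ (lo ≤ (σ (leftPos a) : ℕ) ∧ (σ (rightPos a) : ℕ) ≤ hi)) :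
    Astray lo hi (σ * simpleTransposition a) π := by
  rw [not_and_or, not_le, not_le] at hout
  rcases hout with hlo | hhi
  · exact .inl (lags_mul_swap_of_agree (leftPos_lt_rightPos a) ha hlo
      fun y hy => h y (.inl (lt_of_le_of_lt hy hlo)))
  · have := @lags_mul_swap_of_agree (Fin n) (OrderDual.instLinearOrder (Fin n))
      (fun x : Fin n => hi < (x : ℕ)) σ π
      (rightPos a) (leftPos a) (leftPos_lt_rightPos a) ha hhi
      fun y (hy : σ (rightPos a) ≤ y) => h y (.inr (lt_of_lt_of_le hhi hy))
    right
    rw [simpleTransposition, Equiv.swap_comm]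
    convert this

theorem AgreeOutside.mul_simpleTransposition {n lo hi : ℕ} {σ π : Equiv.Perm (Fin n)}
    (h : AgreeOutside lo hi σ π) (a : Fin (n - 1)) :
    AgreeOutside lo hi (σ * simpleTransposition a) (π * simpleTransposition a) := by
  intro x hx
  rw [simpleTransposition, inv_mul_swap_apply, inv_mul_swap_apply, h x hx]

theorem AgreeOutside.mul_simpleTransposition_left {n lo hi : ℕ} {σ π : Equiv.Perm (Fin n)}
    (h : AgreeOutside lo hi σ π) {a : Fin (n - 1)} (ha : σ (leftPos a) < σ (rightPos a))
    (hin : lo ≤ (σ (leftPos a) : ℕ) ∧ (σ (rightPos a) : ℕ) ≤ hi) :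
    AgreeOutside lo hi (σ * simpleTransposition a) π := by
  intro x hx
  have ha' : (σ (leftPos a) : ℕ) < σ (rightPos a) := ha
  rw [simpleTransposition, inv_mul_swap_apply, Equiv.swap_apply_of_ne_of_ne, h x hx]
  · refine inv_apply_ne σ ?_
    rintro rfl
    omega
  · refine inv_apply_ne σ ?_
    rintro rfl
    omega

open Classical in
/-- The probability that the elements outside an interval end where an ascending word takes them is
the product of the probabilities of the letters that transpose a pair not contained in the interval:
a run that skips such a letter has gone astray and remains astray, and skipping the other letters
does no harm. -/
theorem shuffleOp_agreeOutside {n : ℕ} (lo hi : ℕ) (w : List (Fin (n - 1)))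
    (p : Fin w.length → ℝ) (σ π : Equiv.Perm (Fin n)) (hw : AscendingFrom σ w) :
    (Astray lo hi σ π → shuffleOp (simpleParams w (List.ofFn p))
      (fun τ => if AgreeOutside lo hi (σ * wordProd w) τ then 1 else 0) π = 0) ∧
    (AgreeOutside lo hi σ π → shuffleOp (simpleParams w (List.ofFn p))
      (fun τ => if AgreeOutside lo hi (σ * wordProd w) τ then 1 else 0) π =
      ∏ j : Fin w.length,
        if lo ≤ ((σ * wordProd (w.take j)) (leftPos (w.get j)) : ℕ) ∧
          ((σ * wordProd (w.take j)) (rightPos (w.get j)) : ℕ) ≤ hi then 1 else p j) := by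
  induction w generalizing σ π with
  | nil =>
    simp only [wordProd_nil, mul_one, simpleParams, List.zipWith_nil_left, shuffleOp_nil_apply]
    exact ⟨fun h => if_neg h.not_agreeOutside, fun h => by
      rw [if_pos h]
      rfl⟩
  | cons a w ih =>
    have ih' := fun π => ih (fun j => p j.succ) (σ * simpleTransposition a) π hw.2
    rw [simpleParams_cons, shuffleOp_cons_apply, wordProd_cons, ← mul_assoc]
    constructor
    · intro h
      rw [(ih' _).1 (h.mul_simpleTransposition_left hw.1), ← simpleTransposition,
        (ih' _).1 (h.mul_simpleTransposition hw.1), mul_zero, mul_zero, add_zero]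
    · intro h
      rw [← simpleTransposition, (ih' _).2 (h.mul_simpleTransposition a)]
      refine Eq.trans ?_ (Fin.prod_univ_succ _).symm
      simp only [List.get_eq_getElem, Fin.val_zero, List.take_zero, wordProd_nil, mul_one,
        List.getElem_cons_zero, Fin.val_succ, List.take_succ_cons, wordProd_cons,
        List.getElem_cons_succ, ← mul_assoc]
      simp only [List.get_eq_getElem] at ih'
      split_ifs with hin
      · rw [(ih' _).2 (h.mul_simpleTransposition_left hw.1 hin), ← add_mul, sub_add_cancel]
      · rw [(ih' _).1 (h.astray hw.1 hin), mul_zero, zero_add]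

/-- Whether the pair of elements transposed at step `j` lies between `lo` and `hi`. -/
def CrossesWithin {n : ℕ} (w : List (Fin (n - 1))) (lo hi : ℕ) (j : Fin w.length) : Prop :=
  lo ≤ (leftElement w j : ℕ) ∧ (rightElement w j : ℕ) ≤ hi

open Classical in
theorem IsReducedWord.prod_not_crossesWithin_eq {n : ℕ} {w : List (Fin (n - 1))}
    (hw : IsReducedWord w) {p q : Fin w.length → ℝ}
    (hp : IsTranspositionShuffle (simpleParams w (List.ofFn p)))
    (hq : IsTranspositionShuffle (simpleParams w (List.ofFn q))) (lo hi : ℕ) :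
    (∏ j, if CrossesWithin w lo hi j then 1 else p j) =
      ∏ j, if CrossesWithin w lo hi j then 1 else q j := by
  have h1 := (shuffleOp_agreeOutside lo hi w p 1 1 hw.ascendingFrom_one).2 fun _ _ => rfl
  have h2 := (shuffleOp_agreeOutside lo hi w q 1 1 hw.ascendingFrom_one).2 fun _ _ => rfl
  rw [hp.shuffleOp_apply_one] at h1
  rw [hq.shuffleOp_apply_one, h1] at h2
  simp only [one_mul] at h2
  convert h2 using 3 <;> rfl

theorem IsReducedWord.ne_zero_of_isTranspositionShuffle {n : ℕ} {w : List (Fin (n - 1))}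
    (hw : IsReducedWord w) {p : Fin w.length → ℝ}
    (hp : IsTranspositionShuffle (simpleParams w (List.ofFn p))) (j : Fin w.length) : p j ≠ 0 := by
  classical
  -- If `lo` exceeds `hi`, no pair lies between them, and the event is the reverse permutation.
  have h := (shuffleOp_agreeOutside 1 0 w p 1 1 hw.ascendingFrom_one).2 fun _ _ => rfl
  have hprod : (∏ j, p j) ≠ 0 := by
    have hout : ∀ x y : ℕ, x < y → ¬ (1 ≤ x ∧ y ≤ 0) := by omega
    rw [hp.shuffleOp_apply_one, Finset.prod_congr rfl fun j _ =>
      if_neg (hout _ _ (hw.ascendingFrom_one.left_lt_right j))] at h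
    rw [← h]
    refine div_ne_zero (ne_of_gt ?_) (by exact_mod_cast n.factorial_ne_zero)
    refine Finset.sum_pos' (fun σ _ => by split_ifs <;> norm_num)
      ⟨1 * wordProd w, Finset.mem_univ _, ?_⟩
    rw [if_pos (show AgreeOutside 1 0 _ _ from fun _ _ => rfl)]
    exact one_pos
  exact (Finset.prod_ne_zero_iff.1 hprod) j (Finset.mem_univ _)

open Classical in
theorem IsReducedWord.prod_crossesWithin_eq {n : ℕ} {w : List (Fin (n - 1))}
    (hw : IsReducedWord w) {p q : Fin w.length → ℝ}
    (hp : IsTranspositionShuffle (simpleParams w (List.ofFn p)))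
    (hq : IsTranspositionShuffle (simpleParams w (List.ofFn q))) (lo hi : ℕ) :
    ∏ j with CrossesWithin w lo hi j, p j = ∏ j with CrossesWithin w lo hi j, q j := by
  have hout := hw.prod_not_crossesWithin_eq hp hq lo hi
  have hall := hw.prod_not_crossesWithin_eq hp hq 1 0
  have hnone : ∀ j, ¬ CrossesWithin w 1 0 j := fun j h => by
    have : (leftElement w j : ℕ) < rightElement w j := hw.leftElement_lt_rightElement j
    have h1 := h.1
    have h2 := h.2
    omega
  simp only [hnone, if_false] at hall
  have hsplit : ∀ r : Fin w.length → ℝ, (∏ j with CrossesWithin w lo hi j, r j) *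
      (∏ j, if CrossesWithin w lo hi j then 1 else r j) = ∏ j, r j := by
    intro r
    rw [Finset.prod_filter, ← Finset.prod_mul_distrib]
    refine Finset.prod_congr rfl fun j _ => ?_
    split_ifs <;> simp
  rw [← hsplit p, ← hsplit q, ← hout] at hall
  refine mul_right_cancel₀ ?_ hall
  refine Finset.prod_ne_zero_iff.2 fun j _ => ?_
  split_ifs
  · exact one_ne_zero
  · exact hw.ne_zero_of_isTranspositionShuffle hp j

/-- A reduced word determines the probabilities of a shuffle, by induction on the distance of the
transposed elements: all other pairs between the two elements are closer. -/
theorem IsReducedWord.eq_of_isTranspositionShuffle {n : ℕ} {w : List (Fin (n - 1))}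
    (hw : IsReducedWord w) {p q : Fin w.length → ℝ}
    (hp : IsTranspositionShuffle (simpleParams w (List.ofFn p)))
    (hq : IsTranspositionShuffle (simpleParams w (List.ofFn q))) : p = q := by
  classical
  have key : ∀ (d : ℕ) (j : Fin w.length),
      (rightElement w j : ℕ) - (leftElement w j : ℕ) = d → p j = q j := by
    intro d
    induction d using Nat.strong_induction_on with
    | _ d ih =>
    intro j hd
    have hprod := hw.prod_crossesWithin_eq hp hq (leftElement w j) (rightElement w j)
    have hmem : j ∈ ({i | CrossesWithin w (leftElement w j) (rightElement w j) i} :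
        Finset (Fin w.length)) := by simp [CrossesWithin]
    rw [← Finset.mul_prod_erase _ _ hmem, ← Finset.mul_prod_erase _ q hmem] at hprod
    have hrest : ∀ i ∈ ({i | CrossesWithin w (leftElement w j) (rightElement w j) i} :
        Finset (Fin w.length)).erase j, p i = q i := by
      intro i hi
      rw [Finset.mem_erase, Finset.mem_filter] at hi
      obtain ⟨hne, -, h1, h2⟩ := hi
      refine ih _ ?_ i rfl
      have hlt : (leftElement w i : ℕ) < rightElement w i := hw.leftElement_lt_rightElement i
      have hne' : ¬ ((leftElement w i : ℕ) = leftElement w j ∧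
          (rightElement w i : ℕ) = rightElement w j) := by
        rintro ⟨h3, h4⟩
        refine hne (hw.ascendingFrom_one.injective_crossing ?_)
        simp only [one_mul]
        exact Prod.ext (Fin.ext h3) (Fin.ext h4)
      omega
    rw [Finset.prod_congr rfl hrest] at hprod
    refine mul_right_cancel₀ (Finset.prod_ne_zero_iff.2 fun i _ => ?_) hprod
    exact hw.ne_zero_of_isTranspositionShuffle hq i
  exact funext fun j => key _ j rfl

/-! ### Minimal simple shuffles -/

theorem theorem1 (n : ℕ) :
    IsLeast {l : ℕ | ∃ S : List (LazyParam n), IsSimpleTranspositionShuffle S ∧ S.length = l}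
      (n.choose 2) ∧
    (∀ w : List (Fin (n - 1)), IsReducedWord w →
      IsSimpleTranspositionShuffle (construction w)) ∧
    (∀ S : List (LazyParam n), IsSimpleTranspositionShuffle S → S.length = n.choose 2 →
      ∃ w : List (Fin (n - 1)), IsReducedWord w ∧ S = construction w) ∧
    (∀ w : List (Fin (n - 1)), IsReducedWord w →
      ∃! p : List ℝ, p.length = w.length ∧ IsSimpleTranspositionShuffle (simpleParams w p)) := by
  refine ⟨⟨?_, ?_⟩, fun w hw => hw.isSimpleTranspositionShuffle_construction, ?_, ?_⟩
  · obtain ⟨w, hw⟩ := exists_isReducedWord n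
    exact ⟨construction w, hw.isSimpleTranspositionShuffle_construction, by
      rw [construction_eq, length_simpleParams, hw.1]⟩
  · rintro _ ⟨S, ⟨hS, hsimple⟩, rfl⟩
    obtain ⟨w, p, rfl⟩ := exists_word_of_simple S hsimple
    rw [length_simpleParams]
    exact hS.choose_two_le_length
  · rintro S ⟨hS, hsimple⟩ hl
    obtain ⟨w, p, rfl⟩ := exists_word_of_simple S hsimple
    rw [length_simpleParams] at hl
    have hw := hS.isReducedWord hl
    refine ⟨w, hw, ?_⟩
    rw [construction_eq]
    rw [hw.eq_of_isTranspositionShuffle hS hw.isSimpleTranspositionShuffle_construction.1]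
  · intro w hw
    refine ⟨constructionProbs w, ⟨by simp [constructionProbs],
      hw.isSimpleTranspositionShuffle_construction⟩, ?_⟩
    rintro p ⟨hlen, hp, -⟩
    obtain ⟨q, rfl⟩ : ∃ q : Fin w.length → ℝ, p = List.ofFn q :=
      ⟨fun j => p[j], by
        refine List.ext_getElem (by simp [hlen]) ?_
        simp⟩
    rw [constructionProbs,
      hw.eq_of_isTranspositionShuffle hp hw.isSimpleTranspositionShuffle_construction.1]
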